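/- Rings are associative with identity, and modules are left modules. For a ring $R$, let $R$-space be the set of isomorphism classes of simple $R$-modules, and for $p$ in $R$-space let $N_p$ be a representative of $p$. Call $X \subseteq R\text{-space}$ algebraic if the isomorphism class of every simple subquotient of $\prod_{p\in X} N_p$ lies in $X$. The algebraic sets are the closed sets of a topology, the $R$-topology. For a two-sided ideal $I$ of $R$ put $v(I)=\{p \in R\text{-space} : I\subseteq \operatorname{ann} N_p\}$. The sets $v(I)$ are the closed sets of a topology, the Jacobson topology; for commutative $R$ it is called the Zariski topology on $R$-space. A ring $R$ is a PI ring if there is a polynomial $f$ over $\mathbb Z$ in noncommuting variables, with at least one monomial of highest total degree having coefficient $1$, that vanishes under all substitutions of elements of $R$ for the variables. Proposition 4.1. If $R$ is a PI ring, then the $R$-topology and the Jacobson topology on $R$-space coincide. In particular, if $R$ is commutative, then the $R$-topology and the Zariski topology on $R$-space coincide, and $p \mapsto \operatorname{ann} N_p$ is a homeomorphism from $R$-space with the $R$-topology onto $\operatorname{max} R$, the set of maximal ideals of $R$ with its usual Zariski topology. -/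

import Mathlib

universe u v w

open scoped Topology

noncomputable section

/-- `S` is isomorphic to a subquotient `B / A` of the left `R`-module `M`, where `A ≤ B ≤ M`. -/
def IsSubquotient (R : Type u) [Ring R] (S : Type v) [AddCommGroup S] [Module R S]
    (M : Type w) [AddCommGroup M] [Module R M] : Prop :=
  ∃ (B : Submodule R M) (A : Submodule R B), Nonempty ((B ⧸ A) ≃ₗ[R] S)

/-- The simple left `R`-modules. Every simple module is a quotient of `R`, so that the universe of
`R` contains an isomorphic copy of each of them. -/
abbrev SimpleModules (R : Type u) [Ring R] : Type (u + 1) :=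
  {N : ModuleCat.{u} R // IsSimpleModule R N}

/-- Isomorphism of simple left `R`-modules. -/
def simpleModulesSetoid (R : Type u) [Ring R] : Setoid (SimpleModules R) where
  r N N' := Nonempty (N.1 ≃ₗ[R] N'.1)
  iseqv :=
    { refl := fun _ => ⟨LinearEquiv.refl R _⟩
      symm := fun ⟨e⟩ => ⟨e.symm⟩
      trans := fun ⟨e⟩ ⟨e'⟩ => ⟨e.trans e'⟩ }

/-- `R`-space: the set of isomorphism classes of simple left `R`-modules. -/
def RSpace (R : Type u) [Ring R] : Type (u + 1) := Quotient (simpleModulesSetoid R)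

namespace RSpace

/-- The chosen representative `N_p` of the isomorphism class `p`. -/
def rep {R : Type u} [Ring R] (p : RSpace R) : ModuleCat.{u} R := (Quotient.out p).1

instance isSimpleModule_rep {R : Type u} [Ring R] (p : RSpace R) : IsSimpleModule R p.rep :=
  (Quotient.out p).2

/-- A set `X` of points of `R`-space is algebraic if the class of every simple subquotient of
`∏_{p ∈ X} N_p` lies in `X`. -/
def IsAlgebraic {R : Type u} [Ring R] (X : Set (RSpace R)) : Prop :=
  ∀ q : RSpace R, IsSubquotient R q.rep ((p : X) → p.1.rep) → q ∈ X

/-- `v(I)`: the points `p` of `R`-space with `I ⊆ ann N_p`. -/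
def v {R : Type u} [Ring R] (I : Ideal R) : Set (RSpace R) :=
  {p | I ≤ Module.annihilator R p.rep}

end RSpace

theorem IsSubquotient.of_ker_le {R : Type u} [Ring R] {S : Type*} [AddCommGroup S] [Module R S]
    {M : Type*} [AddCommGroup M] [Module R M] {P : Type*} [AddCommGroup P] [Module R P]
    (f : P →ₗ[R] S) (hf : Function.Surjective f) (g : P →ₗ[R] M)
    (h : LinearMap.ker g ≤ LinearMap.ker f) : IsSubquotient R S M := by
  let φ : LinearMap.range g →ₗ[R] S :=
    ((LinearMap.ker g).liftQ f h).comp g.quotKerEquivRange.symm.toLinearMap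
  have hφ : Function.Surjective φ := by
    intro s
    obtain ⟨x, rfl⟩ := hf s
    exact ⟨g.quotKerEquivRange (Submodule.Quotient.mk x), by simp [φ]⟩
  exact ⟨LinearMap.range g, LinearMap.ker φ, ⟨φ.quotKerEquivOfSurjective hφ⟩⟩

theorem IsSubquotient.exists_surjective {R : Type u} [Ring R] {S : Type*} [AddCommGroup S]
    [Module R S] {M : Type*} [AddCommGroup M] [Module R M] (h : IsSubquotient R S M) :
    ∃ (B : Submodule R M) (f : B →ₗ[R] S), Function.Surjective f := by
  obtain ⟨B, A, ⟨e⟩⟩ := h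
  exact ⟨B, e.toLinearMap.comp A.mkQ, e.surjective.comp A.mkQ_surjective⟩

theorem IsSubquotient.of_injective {R : Type u} [Ring R] {S : Type*} [AddCommGroup S]
    [Module R S] {M M' : Type*} [AddCommGroup M] [Module R M] [AddCommGroup M'] [Module R M']
    (h : IsSubquotient R S M) (g : M →ₗ[R] M') (hg : Function.Injective g) :
    IsSubquotient R S M' := by
  obtain ⟨B, f, hf⟩ := h.exists_surjective
  refine IsSubquotient.of_ker_le f hf (g.comp B.subtype) ?_
  rw [LinearMap.ker_eq_bot.mpr (by simpa using hg.comp B.injective_subtype)]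
  exact bot_le

theorem IsSubquotient.of_pair {R : Type u} [Ring R] {S : Type*} [AddCommGroup S]
    [Module R S] [IsSimpleModule R S] {M M₁ M₂ : Type*} [AddCommGroup M] [Module R M]
    [AddCommGroup M₁] [Module R M₁] [AddCommGroup M₂] [Module R M₂]
    (h : IsSubquotient R S M) (g₁ : M →ₗ[R] M₁) (g₂ : M →ₗ[R] M₂)
    (hg : ∀ m, g₁ m = 0 → g₂ m = 0 → m = 0) :
    IsSubquotient R S M₁ ∨ IsSubquotient R S M₂ := by
  obtain ⟨B, f, hf⟩ := h.exists_surjective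
  let K : Submodule R B := LinearMap.ker (g₁.comp B.subtype)
  rcases eq_bot_or_eq_top (LinearMap.range (f.comp K.subtype)) with h0 | h1
  · refine Or.inl (IsSubquotient.of_ker_le f hf (g₁.comp B.subtype) fun b hb => ?_)
    exact LinearMap.congr_fun (LinearMap.range_eq_bot.mp h0) ⟨b, hb⟩
  · refine Or.inr (IsSubquotient.of_ker_le (f.comp K.subtype) (LinearMap.range_eq_top.mp h1)
      (g₂.comp (B.subtype.comp K.subtype)) fun b hb => ?_)
    have hb0 : ((b : B) : M) = 0 := hg _ b.2 hb
    have : b = 0 := Subtype.ext (Subtype.ext hb0)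
    simp [this]

namespace RSpace

variable {R : Type u} [Ring R]

theorem isAlgebraic_empty : IsAlgebraic (∅ : Set (RSpace R)) := by
  intro q hq
  obtain ⟨B, f, hf⟩ := hq.exists_surjective
  have := IsSimpleModule.nontrivial R q.rep
  have := hf.nontrivial
  exact absurd (inferInstance : Subsingleton B) (not_subsingleton B)

theorem isAlgebraic_sInter (A : Set (Set (RSpace R))) (hA : A ⊆ {X | IsAlgebraic X}) :
    IsAlgebraic (⋂₀ A) := by
  classical
  intro q hq X hX
  refine hA hX q (hq.of_injective
    (LinearMap.pi fun p : X => if h : p.1 ∈ ⋂₀ A then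
      (LinearMap.proj (⟨p.1, h⟩ : ↥(⋂₀ A)) : ((p : ↥(⋂₀ A)) → p.1.rep) →ₗ[R] p.1.rep) else 0) ?_)
  intro m m' h
  funext p
  have h' := congrFun h ⟨p.1, p.2 X hX⟩
  simp only [LinearMap.pi_apply] at h'
  rw [dif_pos p.2] at h'
  exact h'

theorem isAlgebraic_union {X Y : Set (RSpace R)} (hX : IsAlgebraic X) (hY : IsAlgebraic Y) :
    IsAlgebraic (X ∪ Y) := by
  intro q hq
  refine (hq.of_pair
    (LinearMap.pi fun p : X => (LinearMap.proj (⟨p.1, Or.inl p.2⟩ : ↥(X ∪ Y)) :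
      ((p : ↥(X ∪ Y)) → p.1.rep) →ₗ[R] p.1.rep))
    (LinearMap.pi fun p : Y => (LinearMap.proj (⟨p.1, Or.inr p.2⟩ : ↥(X ∪ Y)) :
      ((p : ↥(X ∪ Y)) → p.1.rep) →ₗ[R] p.1.rep)) ?_).imp (hX q) (hY q)
  intro m h₁ h₂
  funext ⟨p, hp⟩
  rcases hp with hp | hp
  · exact congrFun h₁ ⟨p, hp⟩
  · exact congrFun h₂ ⟨p, hp⟩

theorem v_top : v (⊤ : Ideal R) = ∅ := by
  refine Set.eq_empty_iff_forall_notMem.mpr fun p hp => ?_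
  have := IsSimpleModule.nontrivial R p.rep
  obtain ⟨x, hx⟩ := exists_ne (0 : p.rep)
  exact hx (by simpa using Module.mem_annihilator.mp (hp (Submodule.mem_top (x := (1 : R)))) x)

theorem v_inf (I J : Ideal R) [I.IsTwoSided] [J.IsTwoSided] : v (I ⊓ J) = v I ∪ v J := by
  refine Set.Subset.antisymm (fun p hp => ?_) (Set.union_subset
    (fun p (hp : I ≤ _) => show I ⊓ J ≤ _ from le_trans inf_le_left hp)
    (fun p (hp : J ≤ _) => show I ⊓ J ≤ _ from le_trans inf_le_right hp))
  by_contra hn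
  have hI : ¬ I ≤ Module.annihilator R p.rep := fun h => hn (Or.inl h)
  have hJ : ¬ J ≤ Module.annihilator R p.rep := fun h => hn (Or.inr h)
  obtain ⟨a, ha, ha'⟩ := SetLike.not_le_iff_exists.mp hI
  obtain ⟨b, hb, hb'⟩ := SetLike.not_le_iff_exists.mp hJ
  obtain ⟨x, hx⟩ : ∃ x : p.rep, a • x ≠ 0 := by
    by_contra! h
    exact ha' (Module.mem_annihilator.mpr h)
  obtain ⟨y, hy⟩ : ∃ y : p.rep, b • y ≠ 0 := by
    by_contra! h
    exact hb' (Module.mem_annihilator.mpr h)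
  obtain ⟨r, hr⟩ := IsSimpleModule.toSpanSingleton_surjective R hy x
  have hr : r • b • y = x := hr
  have hmem : a * r * b ∈ I ⊓ J :=
    ⟨I.mul_mem_right b (I.mul_mem_right r ha), J.mul_mem_left _ hb⟩
  have h0 : (a * r * b) • y = 0 := Module.mem_annihilator.mp (hp hmem) y
  rw [mul_smul, mul_smul, hr] at h0
  exact hx h0

theorem v_sInter (A : Set (Set (RSpace R)))
    (hA : A ⊆ {X | ∃ I : Ideal R, I.IsTwoSided ∧ X = v I}) :
    ∃ I : Ideal R, I.IsTwoSided ∧ ⋂₀ A = v I := by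
  refine ⟨⨅ p : ↥(⋂₀ A), Module.annihilator R p.1.rep, inferInstance,
    Set.Subset.antisymm
      (fun p hp => show (⨅ q : ↥(⋂₀ A), Module.annihilator R q.1.rep) ≤ _ from
        iInf_le (fun q : ↥(⋂₀ A) => Module.annihilator R q.1.rep) ⟨p, hp⟩)
      fun p hp X hX => ?_⟩
  obtain ⟨I, -, rfl⟩ := hA hX
  exact show I ≤ _ from le_trans (le_iInf fun q : ↥(⋂₀ A) => q.2 _ hX) hp

/-- The `R`-topology on `R`-space: the closed sets are the algebraic sets. -/
abbrev rTopology (R : Type u) [Ring R] : TopologicalSpace (RSpace R) :=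
  TopologicalSpace.ofClosed {X | IsAlgebraic X} isAlgebraic_empty isAlgebraic_sInter
    fun _ hX _ hY => isAlgebraic_union hX hY

/-- The Jacobson topology on `R`-space: the closed sets are the `v(I)` for the two-sided ideals `I`
of `R`. For commutative `R` this is the Zariski topology on `R`-space. -/
abbrev jacobsonTopology (R : Type u) [Ring R] : TopologicalSpace (RSpace R) :=
  TopologicalSpace.ofClosed {X | ∃ I : Ideal R, I.IsTwoSided ∧ X = v I}
    ⟨⊤, inferInstance, v_top.symm⟩ v_sInter
    fun _ ⟨I, _, hX⟩ _ ⟨J, _, hY⟩ =>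
      ⟨I ⊓ J, ⟨fun b ha => ⟨I.mul_mem_right b ha.1, J.mul_mem_right b ha.2⟩⟩, by
        rw [hX, hY, v_inf]⟩

theorem isClosed_rTopology_iff (X : Set (RSpace R)) :
    IsClosed[rTopology R] X ↔ IsAlgebraic X := by
  rw [← @isOpen_compl_iff _ X (rTopology R)]
  change Xᶜᶜ ∈ {X | IsAlgebraic X} ↔ _
  rw [compl_compl]
  rfl

theorem isClosed_jacobsonTopology_iff (X : Set (RSpace R)) :
    IsClosed[jacobsonTopology R] X ↔ ∃ I : Ideal R, I.IsTwoSided ∧ X = v I := by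
  rw [← @isOpen_compl_iff _ X (jacobsonTopology R)]
  change Xᶜᶜ ∈ {X | ∃ I : Ideal R, I.IsTwoSided ∧ X = v I} ↔ _
  rw [compl_compl]
  rfl

end RSpace

/-- A ring is a PI ring if it satisfies a monic polynomial identity: there is a polynomial `f` over
`ℤ` in noncommuting variables (the words in the variables are the elements of the free monoid) such
that some word of the highest total degree has coefficient `1` in `f`, and such that `f` vanishes
under all substitutions of elements of `R` for the variables. -/
def IsPIRing (R : Type u) [Ring R] : Prop :=
  ∃ f : MonoidAlgebra ℤ (FreeMonoid ℕ),
    (∃ m : FreeMonoid ℕ, f.coeff m = 1 ∧ ∀ m' : FreeMonoid ℕ, f.coeff m' ≠ 0 →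
      m'.length ≤ m.length) ∧
    ∀ x : ℕ → R, MonoidAlgebra.lift ℤ R (FreeMonoid ℕ) (FreeMonoid.lift x) f = 0

end

/-! An ideal annihilating every `N_p` with `p ∈ X` annihilates all subquotients of `∏ N_p`, so each
`v I` is algebraic. Conversely let `X` be algebraic and `I` the intersection of the annihilators of
the `N_p`, `p ∈ X`. By Jacobson density, a polynomial identity bounds the dimensions of all simple
modules over their endomorphism division rings by one `n` (`IsPIRing.exists_annihilator_eq`).
Spanning `n`-tuples of the `N_p` then form one element of `(∏ N_p) ^ n` with annihilator `I`, so `R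
⧸ I` embeds there. A simple module killed by `I` is a quotient of `R ⧸ I`, hence a subquotient of
the power, hence of `∏ N_p` itself (`IsSubquotient.of_fin_pow`). -/

/-- A linear independent family over the endomorphism ring of a simple module can be moved to any
prescribed family of vectors by the action of a ring element. -/
theorem exists_smul_eq_of_linearIndependent {R : Type*} [Ring R] {N : Type*} [AddCommGroup N]
    [Module R N] [IsSimpleModule R N] {ι : Type*} [Finite ι] {v : ι → N}
    (hv : LinearIndependent (Module.End R N) v) (y : ι → N) : ∃ r : R, ∀ i, r • v i = y i := by
  classical
  have := Fintype.ofFinite ι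
  obtain ⟨f, hf⟩ := LinearMap.exists_extend ((Module.Basis.span hv).constr ℕ y)
  obtain ⟨r, hr⟩ := jacobson_density f (Finset.univ.image v)
  refine ⟨r, fun i => ?_⟩
  rw [← hr (v i) (Finset.mem_image_of_mem v (Finset.mem_univ i))]
  have h := LinearMap.congr_fun hf (Module.Basis.span hv i)
  rw [Module.Basis.constr_basis] at h
  simpa [Module.Basis.span_apply] using h

/-- The vectors are indexed by the suffixes of `w`; a ring element attached to the letter `i` sends
the vector at `u` to the vector at `i :: u`. -/
theorem not_linearIndependent_tails {R : Type*} [Ring R] {N : Type*} [AddCommGroup N] [Module R N]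
    [IsSimpleModule R N] {f : MonoidAlgebra ℤ (FreeMonoid ℕ)} {w : FreeMonoid ℕ}
    (hw : f.coeff w = 1)
    (hf : ∀ x : ℕ → R, MonoidAlgebra.lift ℤ R (FreeMonoid ℕ) (FreeMonoid.lift x) f = 0)
    (v : ↥(w.toList.tails.toFinset) → N) : ¬ LinearIndependent (Module.End R N) v := by
  classical
  intro hv
  -- Extending by zero is consistent with the action of the letters: if `u` is not a suffix of `w`,
  -- neither is `i :: u`.
  let V : List ℕ → N := fun u => if h : u ∈ w.toList.tails.toFinset then v ⟨u, h⟩ else 0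
  have hV : ∀ u (h : u ∈ w.toList.tails.toFinset), V u = v ⟨u, h⟩ := fun u h => dif_pos h
  have hV0 : ∀ u, u ∉ w.toList.tails.toFinset → V u = 0 := fun u h => dif_neg h
  choose x hx using fun i : ℕ => exists_smul_eq_of_linearIndependent hv fun u => V (i :: u.1)
  -- `r` isolates the word `w`: it fixes its vector and kills those of all other words.
  obtain ⟨r, hr⟩ := exists_smul_eq_of_linearIndependent hv
    fun u => if u.1 = w.toList then V w.toList else 0
  have hword : ∀ u : List ℕ, (u.map x).prod • V [] = V u := by
    intro u
    induction u with
    | nil => simp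
    | cons i u ih =>
      rw [List.map_cons, List.prod_cons, mul_smul, ih]
      by_cases hu : u ∈ w.toList.tails.toFinset
      · rw [hV u hu, hx]
      · rw [hV0 u hu, hV0, smul_zero]
        simp only [List.mem_toFinset, List.mem_tails] at hu ⊢
        exact fun h => hu ((List.suffix_cons i u).trans h)
  have hmem : w.toList ∈ w.toList.tails.toFinset := by simp
  have hrV : ∀ u : List ℕ, r • V u = if u = w.toList then V w.toList else 0 := by
    intro u
    by_cases hu : u ∈ w.toList.tails.toFinset
    · rw [hV u hu, hr]
    · rw [hV0 u hu, smul_zero, if_neg (fun h : u = w.toList => hu (h ▸ hmem))]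
  have hne : V w.toList ≠ 0 := by
    have := IsSimpleModule.nontrivial R N
    rw [hV _ hmem]
    exact hv.ne_zero _
  have h0 : r • MonoidAlgebra.lift ℤ R (FreeMonoid ℕ) (FreeMonoid.lift x) f • V [] = 0 := by
    rw [hf x, zero_smul, smul_zero]
  -- Evaluating `f` on `V []` gives the sum of the `f.coeff u • V u`; applying `r` leaves only `V
  -- w.toList`, with coefficient 1.
  rw [MonoidAlgebra.lift_apply, Finsupp.sum, Finset.sum_smul, Finset.smul_sum,
    Finset.sum_eq_single w] at h0
  · rw [FreeMonoid.lift_apply, hw, one_smul, hword, hrV, if_pos rfl] at h0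
    exact hne h0
  · intro u _ hu
    rw [FreeMonoid.lift_apply, smul_assoc, hword, smul_comm, hrV, if_neg, smul_zero]
    exact fun h => hu (FreeMonoid.toList.injective h)
  · intro h
    rw [Finsupp.notMem_support_iff.mp h, zero_smul, zero_smul, smul_zero]

/-- Over a PI ring there is a uniform `n` such that every simple module contains `n` elements whose
common annihilator is the annihilator of the module. -/
theorem IsPIRing.exists_annihilator_eq {R : Type u} [Ring R] (hR : IsPIRing R) :
    ∃ n : ℕ, ∀ (N : Type u) [AddCommGroup N] [Module R N] [IsSimpleModule R N],
      ∃ y : Fin n → N, ∀ r : R, (∀ i, r • y i = 0) → r ∈ Module.annihilator R N := by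
  classical
  obtain ⟨f, ⟨w, hw, -⟩, hf⟩ := hR
  refine ⟨w.toList.tails.toFinset.card, fun N _ _ _ => ?_⟩
  have hlt : Module.rank (Module.End R N) N < (w.toList.tails.toFinset.card : Cardinal) := by
    by_contra! hle
    obtain ⟨s, hs, hli⟩ := le_rank_iff_exists_linearIndependent_finset.mp hle
    let e : ↥(w.toList.tails.toFinset) ≃ ↥s := Finset.equivOfCardEq hs.symm
    exact not_linearIndependent_tails hw hf _ (hli.comp e e.injective)
  have hfin : Module.Finite (Module.End R N) N :=
    Module.rank_lt_aleph0_iff.mp (hlt.trans Cardinal.natCast_lt_aleph0)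
  have hle : Module.finrank (Module.End R N) N ≤ w.toList.tails.toFinset.card := by
    rw [← Module.finrank_eq_rank, Nat.cast_lt] at hlt
    exact hlt.le
  let b := Module.finBasis (Module.End R N) N
  -- Padding a basis with zeros makes the length of the tuple independent of `N`.
  refine ⟨fun i => if h : i.1 < Module.finrank (Module.End R N) N then b ⟨i, h⟩ else 0,
    fun r hr => Module.mem_annihilator.mpr fun m => ?_⟩
  -- The action of `r` is linear over `Module.End R N`, so it vanishes once it vanishes on a basis.
  have h0 : Module.toModuleEnd (Module.End R N) (S := R) N r = 0 := by
    refine b.ext fun j => ?_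
    simpa using hr ⟨j, j.2.trans_le hle⟩
  exact LinearMap.congr_fun h0 m

/-- Splitting off one coordinate at a time, a simple subquotient must already occur in one of the
factors. -/
theorem IsSubquotient.of_fin_pow {R : Type u} [Ring R] {S : Type*} [AddCommGroup S] [Module R S]
    [IsSimpleModule R S] {M : Type*} [AddCommGroup M] [Module R M] {n : ℕ}
    (h : IsSubquotient R S (Fin n → M)) : IsSubquotient R S M := by
  induction n with
  | zero => exact h.of_injective 0 (Function.injective_of_subsingleton _)
  | succ n ih =>
    refine (h.of_pair (LinearMap.proj 0) (LinearMap.funLeft R M Fin.succ) fun m h₀ h₁ => ?_).elim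
      id ih
    funext i
    exact Fin.cases h₀ (fun j => congrFun h₁ j) i

/-! ### Comparison of the two topologies. -/

namespace RSpace

theorem isAlgebraic_v {R : Type u} [Ring R] (I : Ideal R) : IsAlgebraic (v I) := by
  intro q hq a ha
  obtain ⟨B, f, hf⟩ := hq.exists_surjective
  refine Module.mem_annihilator.mpr fun m => ?_
  obtain ⟨b, rfl⟩ := hf m
  have hb : a • b = 0 := Subtype.ext (funext fun p => Module.mem_annihilator.mp (p.2 ha) _)
  rw [← map_smul, hb, map_zero]

theorem eq_v_of_isAlgebraic {R : Type u} [Ring R] (hR : IsPIRing R) {X : Set (RSpace R)}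
    (hX : IsAlgebraic X) : X = v (⨅ p : X, Module.annihilator R p.1.rep) := by
  refine Set.Subset.antisymm (fun p hp => iInf_le
    (fun q : X => Module.annihilator R q.1.rep) ⟨p, hp⟩) fun q hq => hX q ?_
  obtain ⟨n, hn⟩ := hR.exists_annihilator_eq
  choose y hy using fun p : RSpace R => hn p.rep
  have := IsSimpleModule.nontrivial R q.rep
  obtain ⟨s, hs⟩ := exists_ne (0 : q.rep)
  -- The cyclic submodule generated by the tuple of all `y p.1 i` maps onto `q.rep` by sending the
  -- generator to `s`: whatever kills the generator lies in every `ann N_p`, hence in `ann N_q`.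
  refine IsSubquotient.of_fin_pow (n := n) (IsSubquotient.of_ker_le (LinearMap.toSpanSingleton R _ s)
    (IsSimpleModule.toSpanSingleton_surjective R hs)
    (LinearMap.toSpanSingleton R (Fin n → (p : X) → p.1.rep) fun i p => y p.1 i) fun r hr => ?_)
  refine Module.mem_annihilator.mp (hq ((Submodule.mem_iInf _).mpr fun p => hy p.1 r fun i => ?_)) s
  exact congrFun (congrFun hr i) p

theorem rTopology_eq_jacobsonTopology {R : Type u} [Ring R] (hR : IsPIRing R) :
    rTopology R = jacobsonTopology R := by
  refine TopologicalSpace.ext_iff_isClosed.mpr fun X => ?_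
  rw [isClosed_rTopology_iff, isClosed_jacobsonTopology_iff]
  exact ⟨fun hX => ⟨_, inferInstance, eq_v_of_isAlgebraic hR hX⟩,
    fun ⟨I, _, hI⟩ => hI ▸ isAlgebraic_v I⟩

/-! ### Commutative rings and the maximal spectrum. -/

theorem eq_of_annihilator_eq {R : Type u} [CommRing R] {p q : RSpace R}
    (h : Module.annihilator R p.rep = Module.annihilator R q.rep) : p = q := by
  -- Over a commutative ring a simple module is `R ⧸ I` with `I` its annihilator, which thus
  -- determines its class.
  obtain ⟨I, -, ⟨e⟩⟩ := isSimpleModule_iff_quot_maximal.mp (isSimpleModule_rep p)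
  obtain ⟨J, -, ⟨e'⟩⟩ := isSimpleModule_iff_quot_maximal.mp (isSimpleModule_rep q)
  rw [e.annihilator_eq, e'.annihilator_eq, Ideal.annihilator_quotient,
    Ideal.annihilator_quotient] at h
  subst h
  exact Quotient.out_equiv_out.mp ⟨e.trans e'.symm⟩

/-- The point of `R`-space of a maximal ideal `M` is the class of `R ⧸ M`. -/
theorem exists_annihilator_eq {R : Type u} [CommRing R] (M : MaximalSpectrum R) :
    ∃ p : RSpace R, Module.annihilator R p.rep = M.asIdeal := by
  have hM : IsSimpleModule R (R ⧸ M.asIdeal) :=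
    isSimpleModule_iff_quot_maximal.mpr ⟨_, M.isMaximal, ⟨LinearEquiv.refl R _⟩⟩
  let N : SimpleModules R := ⟨ModuleCat.of R (R ⧸ M.asIdeal), hM⟩
  obtain ⟨e⟩ : Nonempty ((Quotient.out (Quotient.mk (simpleModulesSetoid R) N)).1 ≃ₗ[R] N.1) :=
    Quotient.mk_out (s := simpleModulesSetoid R) N
  exact ⟨Quotient.mk _ N, e.annihilator_eq.trans Ideal.annihilator_quotient⟩

/-- For a commutative ring, `p ↦ ann N_p` is a bijection from `R`-space onto the set of maximal
ideals. -/
noncomputable def equivMaximalSpectrum (R : Type u) [CommRing R] : RSpace R ≃ MaximalSpectrum R :=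
  Equiv.ofBijective
    (fun p => ⟨Module.annihilator R p.rep, IsSimpleModule.annihilator_isMaximal⟩)
    ⟨fun _ _ h => eq_of_annihilator_eq (congrArg MaximalSpectrum.asIdeal h),
      fun M => (exists_annihilator_eq M).imp fun _ h => MaximalSpectrum.ext h⟩

theorem isHomeomorph_equivMaximalSpectrum (R : Type u) [CommRing R] :
    @IsHomeomorph (RSpace R) (MaximalSpectrum R) (jacobsonTopology R)
      MaximalSpectrum.zariskiTopology (equivMaximalSpectrum R) := by
  let _ : TopologicalSpace (RSpace R) := jacobsonTopology R
  -- The bijection matches zero loci with the sets `v I`, so closed sets correspond in both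
  -- directions.
  have hv : ∀ s : Set R, equivMaximalSpectrum R ⁻¹'
      (MaximalSpectrum.toPrimeSpectrum ⁻¹' PrimeSpectrum.zeroLocus s) = v (Ideal.span s) :=
    fun s => Set.ext fun p => Ideal.span_le.symm
  refine isHomeomorph_iff_continuous_isClosedMap_bijective.mpr
    ⟨continuous_iff_isClosed.mpr fun Z hZ => ?_, fun X hX => ?_, (equivMaximalSpectrum R).bijective⟩
  · obtain ⟨Z', hZ', rfl⟩ := isClosed_induced_iff.mp hZ
    obtain ⟨s, rfl⟩ := (PrimeSpectrum.isClosed_iff_zeroLocus Z').mp hZ'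
    exact (isClosed_jacobsonTopology_iff _).mpr ⟨_, inferInstance, hv s⟩
  · obtain ⟨I, -, rfl⟩ := (isClosed_jacobsonTopology_iff X).mp hX
    rw [← Ideal.span_eq I, ← hv, Set.image_preimage_eq _ (equivMaximalSpectrum R).surjective]
    exact isClosed_induced_iff.mpr ⟨_, PrimeSpectrum.isClosed_zeroLocus _, rfl⟩

end RSpace

/-- A commutative ring satisfies the identity `x y - y x`. -/
theorem isPIRing_of_commRing (R : Type u) [CommRing R] : IsPIRing R := by
  have hne : (FreeMonoid.of 1 * FreeMonoid.of 0 : FreeMonoid ℕ) ≠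
      FreeMonoid.of 0 * FreeMonoid.of 1 := fun h => by
    simpa using congrArg FreeMonoid.toList h
  refine ⟨MonoidAlgebra.single (FreeMonoid.of 0 * FreeMonoid.of 1) 1 -
    MonoidAlgebra.single (FreeMonoid.of 1 * FreeMonoid.of 0) 1,
    ⟨FreeMonoid.of 0 * FreeMonoid.of 1, ?_, fun m hm => ?_⟩, fun x => ?_⟩
  · simp [hne]
  · by_contra! hlt
    refine hm ?_
    have h₁ : FreeMonoid.of 0 * FreeMonoid.of 1 ≠ m := by rintro rfl; exact lt_irrefl _ hlt
    have h₂ : FreeMonoid.of 1 * FreeMonoid.of 0 ≠ m := by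
      rintro rfl
      simp [FreeMonoid.length_mul] at hlt
    simp [h₁, h₂]
  · simp [MonoidAlgebra.lift_single, mul_comm]

theorem proposition4p1 :
    (∀ (R : Type u) [Ring R], IsPIRing R → RSpace.rTopology R = RSpace.jacobsonTopology R) ∧
    (∀ (R : Type u) [CommRing R],
      RSpace.rTopology R = RSpace.jacobsonTopology R ∧
      ∃ e : RSpace R ≃ MaximalSpectrum R,
        (∀ p : RSpace R, (e p).asIdeal = Module.annihilator R p.rep) ∧
        @IsHomeomorph (RSpace R) (MaximalSpectrum R) (RSpace.rTopology R)
          MaximalSpectrum.zariskiTopology e) := by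
  refine ⟨fun R _ hR => RSpace.rTopology_eq_jacobsonTopology hR, fun R _ => ?_⟩
  have h := RSpace.rTopology_eq_jacobsonTopology (isPIRing_of_commRing R)
  refine ⟨h, RSpace.equivMaximalSpectrum R, fun _ => rfl, ?_⟩
  rw [h]
  exact RSpace.isHomeomorph_equivMaximalSpectrum R
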